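/- Let $\mathcal T$ be a tree (a connected simple graph without cycles), $k\ge 1$ an integer, and $G\le \mathrm{Aut}(\mathcal T)$ a subgroup. Write $d$ for the graph distance, $B(v,k)$ for the closed ball of radius $k$ about a vertex $v$, and $\mathrm{Fix}_G(X)$ for the group of elements of $G$ fixing every vertex in $X$. Paths have no backtracking; a path may be finite, infinite or doubly infinite. An end of $\mathcal T$ is an equivalence class of infinite paths, two infinite paths being equivalent if their intersection is an infinite path. For a path $C$ in $\mathcal T$ let $C^{k-1}$ be the set of vertices at distance at most $k-1$ from $C$, let $\pi$ be the projection sending each vertex of $\mathcal T$ to the closest vertex of $C$, and for each vertex $x$ of $C$ let $F_x$ be the permutation group induced by $\mathrm{Fix}_G(C^{k-1})$ on $\pi^{-1}(x)$. We say that $G$ satisfies Property $P_k$ if for every path $C$ in $\mathcal T$ the natural homomorphism $\mathrm{Fix}_G(C^{k-1})\to\prod_{x\in V(C)}F_x$ is an isomorphism. Let $G^{+_k}$ be the subgroup of $G$ generated by all $g\in G$ for which there is an edge $(v,w)$ of $\mathcal T$ such that $g$ fixes every vertex of $B(v,k)\cap B(w,k)$. **Theorem.** Suppose that $G$ satisfies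 Property $P_k$, and that $G$ stabilises no proper non-empty subtree of $\mathcal T$ and no end of $\mathcal T$. Then every nontrivial subgroup of $G$ that is normalised by $G^{+_k}$ contains $G^{+_k}$. In particular, $G^{+_k}$ is simple or trivial. -/

import Mathlib

namespace TreeAut

universe u

variable {V : Type u} {T : SimpleGraph V}

/-- The closed ball `B(v, k)` (its set of vertices). -/
def ball (T : SimpleGraph V) (v : V) (k : ℕ) : Set V := {x | T.dist v x ≤ k}

/-- The set of vertices at distance at most `k` from the vertex set `X`. -/
def nbhd (T : SimpleGraph V) (X : Set V) (k : ℕ) : Set V := {v | ∃ x ∈ X, T.dist v x ≤ k}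

/-- An infinite path (without backtracking), given by its sequence of vertices. -/
def IsInfinitePath (T : SimpleGraph V) (r : ℕ → V) : Prop :=
  ∀ n, T.Adj (r n) (r (n + 1)) ∧ r n ≠ r (n + 2)

/-- A doubly-infinite path (without backtracking), given by its sequence of vertices. -/
def IsDoublyInfinitePath (T : SimpleGraph V) (r : ℤ → V) : Prop :=
  ∀ n, T.Adj (r n) (r (n + 1)) ∧ r n ≠ r (n + 2)

/-- `C` is the vertex set of a path of `T`: finite, infinite or doubly-infinite. -/
def IsPathSet (T : SimpleGraph V) (C : Set V) : Prop :=
  (∃ (a b : V) (p : T.Walk a b), p.IsPath ∧ C = {x | x ∈ p.support}) ∨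
  (∃ r : ℕ → V, IsInfinitePath T r ∧ C = Set.range r) ∨
  (∃ r : ℤ → V, IsDoublyInfinitePath T r ∧ C = Set.range r)

/-- Two infinite paths are equivalent if their intersection is an infinite path. The equivalence
classes are the ends of the tree. -/
def SameEnd (T : SimpleGraph V) (r s : ℕ → V) : Prop :=
  ∃ t : ℕ → V, IsInfinitePath T t ∧ Set.range t = Set.range r ∩ Set.range s

/-- `G` stabilises an end, namely the end of some infinite path `r`: every element of `G` maps
every representative of that end to a representative of it. -/
def StabilisesAnEnd (G : Subgroup (T ≃g T)) : Prop :=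
  ∃ r : ℕ → V, IsInfinitePath T r ∧
    ∀ g ∈ G, ∀ s : ℕ → V, IsInfinitePath T s → SameEnd T s r → SameEnd T (fun n => g (s n)) r

/-- `G` stabilises a proper non-empty subtree. A subtree of a tree is the subgraph induced on its
vertex set. -/
def StabilisesAProperSubtree (G : Subgroup (T ≃g T)) : Prop :=
  ∃ S : Set V, (T.induce S).IsTree ∧ S ≠ Set.univ ∧ ∀ g ∈ G, (fun x => g x) '' S = S

/-- `Fix_G(X)`: the elements of `G` that fix every vertex in `X`. -/
def fixator (G : Subgroup (T ≃g T)) (X : Set V) : Subgroup (T ≃g T) where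
  carrier := {g | g ∈ G ∧ ∀ x ∈ X, g x = x}
  one_mem' := ⟨G.one_mem, fun _ _ => rfl⟩
  mul_mem' := by
    rintro a b ⟨ha, ha'⟩ ⟨hb, hb'⟩
    refine ⟨G.mul_mem ha hb, fun x hx => ?_⟩
    rw [RelIso.mul_apply, hb' x hx, ha' x hx]
  inv_mem' := by
    rintro a ⟨ha, ha'⟩
    refine ⟨G.inv_mem ha, fun x hx => ?_⟩
    conv_lhs => rw [← ha' x hx]
    exact RelIso.inv_apply_self a x

/-- The fibre `π⁻¹(x)` of the projection `π` of the vertices of `T` onto `C`, for `x` in `C`: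
the vertices for which `x` is the closest vertex of `C`. -/
def fibre (T : SimpleGraph V) (C : Set V) (x : V) : Set V :=
  {v | ∀ y ∈ C, T.dist v x ≤ T.dist v y}

theorem dist_map_iso (g : T ≃g T) (a b : V) : T.dist (g a) (g b) = T.dist a b := by
  have key : ∀ (h : T ≃g T) (a b : V), T.Reachable a b → T.dist (h a) (h b) ≤ T.dist a b := by
    intro h a b hab
    obtain ⟨p, hp⟩ := hab.exists_walk_length_eq_dist
    rw [← hp, ← SimpleGraph.Walk.length_map h.toHom p]
    exact SimpleGraph.dist_le (p.map h.toHom)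
  by_cases hab : T.Reachable a b
  · refine le_antisymm (key g a b hab) ?_
    have h := key g.symm (g a) (g b) (hab.map g.toHom)
    rwa [g.symm_apply_apply, g.symm_apply_apply] at h
  · have h' : ¬ T.Reachable (g a) (g b) := fun h => hab (by
      have h2 := h.map g.symm.toHom
      change T.Reachable (g.symm (g a)) (g.symm (g b)) at h2
      rwa [g.symm_apply_apply, g.symm_apply_apply] at h2)
    rw [SimpleGraph.dist_eq_zero_of_not_reachable hab,
      SimpleGraph.dist_eq_zero_of_not_reachable h']

theorem fixator_nbhd_apply {G : Subgroup (T ≃g T)} {C : Set V} {n : ℕ} {g : T ≃g T}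
    (hg : g ∈ fixator G (nbhd T C n)) {x : V} (hx : x ∈ C) : g x = x :=
  hg.2 x ⟨x, hx, by simp⟩

theorem apply_mem_fibre {G : Subgroup (T ≃g T)} {C : Set V} {n : ℕ} {g : T ≃g T}
    (hg : g ∈ fixator G (nbhd T C n)) {x : V} (hx : x ∈ C) {v : V} (hv : v ∈ fibre T C x) :
    g v ∈ fibre T C x := by
  intro y hy
  have h1 := dist_map_iso g v x
  have h2 := dist_map_iso g v y
  rw [fixator_nbhd_apply hg hx] at h1
  rw [fixator_nbhd_apply hg hy] at h2
  rw [h1, h2]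
  exact hv y hy

/-- The action of `Fix_G(C^n)` on the fibre `π⁻¹(x)`, for `x` in `C`. -/
def fibreAction (G : Subgroup (T ≃g T)) (C : Set V) (n : ℕ) (x : C) :
    fixator G (nbhd T C n) →* Equiv.Perm (fibre T C x) where
  toFun g :=
    { toFun := fun v => ⟨g.1 v.1, apply_mem_fibre g.2 x.2 v.2⟩
      invFun := fun v => ⟨(g⁻¹).1 v.1, apply_mem_fibre (g⁻¹).2 x.2 v.2⟩
      left_inv := fun v => Subtype.ext (RelIso.inv_apply_self g.1 v.1)
      right_inv := fun v => Subtype.ext (RelIso.apply_inv_self g.1 v.1) }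
  map_one' := rfl
  map_mul' _ _ := rfl

/-- The natural homomorphism `Φ` from `Fix_G(C^n)` to the product over `x` in `C` of the
permutation groups `F_x` that `Fix_G(C^n)` induces on the fibres `π⁻¹(x)`. -/
def natHom (G : Subgroup (T ≃g T)) (C : Set V) (n : ℕ) :
    fixator G (nbhd T C n) →* ((x : C) → (fibreAction G C n x).range) :=
  MonoidHom.mk' (fun g x => (fibreAction G C n x).rangeRestrict g) (fun a b => by
    funext x
    exact map_mul (fibreAction G C n x).rangeRestrict a b)

/-- Property `P_k` (for `k ≥ 1`): for every path `C`, the natural homomorphism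
`Φ : Fix_G(C^{k-1}) → ∏_{x ∈ C} F_x` is an isomorphism. -/
def PropertyP (k : ℕ) (G : Subgroup (T ≃g T)) : Prop :=
  ∀ C : Set V, IsPathSet T C → Function.Bijective (natHom G C (k - 1))

/-- `G^{+_k}`: the subgroup generated by the elements of `G` that fix `B(v,k) ∩ B(w,k)` for some
edge `(v, w)`. -/
def plus (k : ℕ) (G : Subgroup (T ≃g T)) : Subgroup (T ≃g T) :=
  Subgroup.closure {g | ∃ v w : V, T.Adj v w ∧ g ∈ fixator G (ball T v k ∩ ball T w k)}

end TreeAut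

/-! Deleting an edge cuts the tree into two half-trees. If a half-tree met all its `G`-translates,
any two translates would meet. Their common intersection would then be an invariant proper subtree
or, if it is empty, stepping from each vertex towards a translate that misses it would be a
`G`-equivariant flow, whose orbits represent a fixed end. So `G` moves every half-tree off itself
(`flips_of_minimal`) and can carry any half-tree into any other.

Conjugation passes this on to every subgroup normalised by `G` that moves a single half-tree off
itself (`Flips.of_normalised`). A nontrivial generator of `plus k G` fixes an edge, which yields
such a half-tree and a branch vertex. Hence `plus k G` flips, and so does every nontrivial `H`
normalised by it (`Flips.of_ne_bot`).

The rest is Tits' commutator argument. Property `P_k` for one edge splits a generator into two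
factors, each supported on one half-tree (`mem_of_mem_fixator`). If `g` is supported on a half-tree
`B`, some translation `h ∈ H` has an axis avoiding `B`. Property `P_k` along a ray of that axis
glues the conjugates `h ^ i * g * (h ^ i)⁻¹`, `i ≥ 0`, into one `f ∈ plus k G`. Conjugating `f` by
`h` drops the factor `i = 0`, so `g = (f * h * f⁻¹) * h⁻¹` lies in `H` (`mem_of_fixes_halfTree`). -/

namespace TreeAut

variable {V : Type*} {T : SimpleGraph V}

/-! ### Half-trees and their relative positions -/

/-- In a tree, the neighbour of `x` one step closer to `z` is unique. -/
theorem closer_neighbour_unique (hT : T.IsTree) {x y y' z : V} (h : T.Adj x y) (h' : T.Adj x y')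
    (hy : T.dist y z + 1 = T.dist x z) (hy' : T.dist y' z + 1 = T.dist x z) : y = y' := by
  obtain ⟨p, hp⟩ := hT.connected.exists_walk_length_eq_dist y z
  obtain ⟨p', hp'⟩ := hT.connected.exists_walk_length_eq_dist y' z
  have hq : (SimpleGraph.Walk.cons h p).IsPath :=
    SimpleGraph.Walk.isPath_of_length_eq_dist _ (by rw [SimpleGraph.Walk.length_cons, hp, hy])
  have hq' : (SimpleGraph.Walk.cons h' p').IsPath :=
    SimpleGraph.Walk.isPath_of_length_eq_dist _ (by rw [SimpleGraph.Walk.length_cons, hp', hy'])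
  have := congrArg (fun q : T.Path x z => (q : T.Walk x z).snd)
    ((hT.isAcyclic.subsingleton_path x z).elim ⟨_, hq⟩ ⟨_, hq'⟩)
  simpa using this

theorem exists_closer_neighbour (hT : T.IsTree) {x z : V} (h : x ≠ z) :
    ∃ y, T.Adj x y ∧ T.dist y z + 1 = T.dist x z := by
  obtain ⟨p, hp⟩ := hT.connected.exists_walk_length_eq_dist x z
  cases p with
  | nil => exact absurd rfl h
  | @cons _ y _ hadj q =>
    refine ⟨y, hadj, ?_⟩
    have h1 := SimpleGraph.dist_le q
    rw [SimpleGraph.Walk.length_cons] at hp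
    rcases hT.dist_eq_dist_add_one_of_adj z hadj with h2 | h2 <;>
      rw [T.dist_comm, T.dist_comm (u := z)] at h2 <;> omega

/-- The vertices on the side of `w` of the edge `(v, w)`. -/
def halfTree (T : SimpleGraph V) (v w : V) : Set V := {x | T.dist x w < T.dist x v}

theorem dist_adj_cases (hT : T.IsTree) {v w : V} (h : T.Adj v w) (x : V) :
    (x ∈ halfTree T v w ∧ x ∉ halfTree T w v ∧ T.dist x v = T.dist x w + 1) ∨
      (x ∈ halfTree T w v ∧ x ∉ halfTree T v w ∧ T.dist x w = T.dist x v + 1) := by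
  simp only [halfTree, Set.mem_ofPred_eq]
  rcases hT.dist_eq_dist_add_one_of_adj x h with h | h <;> omega

theorem notMem_halfTree (hT : T.IsTree) {v w : V} (h : T.Adj v w) {x : V} :
    x ∉ halfTree T v w ↔ x ∈ halfTree T w v := by
  have := dist_adj_cases hT h x
  tauto

theorem dist_of_mem_halfTree (hT : T.IsTree) {v w : V} (h : T.Adj v w) {x : V}
    (hx : x ∈ halfTree T v w) : T.dist x v = T.dist x w + 1 := by
  have := dist_adj_cases hT h x
  tauto

theorem right_mem_halfTree {v w : V} (h : T.Adj v w) : w ∈ halfTree T v w := by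
  simp [halfTree, SimpleGraph.dist_eq_one_iff_adj.2 h.symm]

theorem left_notMem_halfTree {v w : V} : v ∉ halfTree T v w := by
  simp [halfTree]

/-- A geodesic leaving a half-tree passes through its bounding edge. -/
theorem dist_eq_of_mem_halfTree (hT : T.IsTree) {v w : V} (h : T.Adj v w) {x y : V}
    (hx : x ∈ halfTree T v w) (hy : y ∉ halfTree T v w) :
    T.dist x y = T.dist x v + T.dist v y := by
  induction hn : T.dist v y generalizing y with
  | zero =>
    rw [(hT.connected.dist_eq_zero_iff).1 hn]; rfl
  | succ n ih =>
    have hne : y ≠ v := by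
      rintro rfl
      simp at hn
    obtain ⟨y', hyy', hy'⟩ := exists_closer_neighbour hT hne
    rw [T.dist_comm] at hn
    have hyw := dist_of_mem_halfTree hT h.symm ((notMem_halfTree hT h).1 hy)
    have hyw' := T.dist_comm (u := y') (v := v)
    have htri := hT.connected.dist_triangle (u := y) (v := y') (w := w)
    have h1 := SimpleGraph.dist_eq_one_iff_adj.2 hyy'
    have hy'mem : y' ∉ halfTree T v w := by
      simp only [halfTree, Set.mem_ofPred_eq]
      omega
    have hd := ih hy'mem (by omega)
    rcases hT.dist_eq_dist_add_one_of_adj x hyy' with h2 | h2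
    · omega
    -- Here `y` is the neighbour of `y'` closer to `x`. That neighbour is `w` if `y' = v`, and
    -- otherwise the one closer to `v`; neither can be `y`.
    · exfalso
      rw [T.dist_comm (u := x), T.dist_comm (u := x)] at h2
      by_cases hv : y' = v
      · subst hv
        have : y = w := closer_neighbour_unique hT hyy'.symm h h2.symm (by
          rw [T.dist_comm, ← dist_of_mem_halfTree hT h hx, T.dist_comm])
        subst this
        exact hy (right_mem_halfTree h)
      · obtain ⟨y'', ha, hb⟩ := exists_closer_neighbour hT hv
        have h3 := hT.connected.dist_triangle (u := x) (v := v) (w := y'')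
        have h5 := hT.connected.dist_triangle (u := y'') (v := v) (w := x)
        have h4 : y'' ∉ halfTree T v w := by
          intro h4
          have := dist_of_mem_halfTree hT h h4
          have := dist_of_mem_halfTree hT h.symm ((notMem_halfTree hT h).1 hy'mem)
          have h6 := hT.connected.dist_triangle (u := y') (v := y'') (w := w)
          have := SimpleGraph.dist_eq_one_iff_adj.2 ha
          omega
        have h7 : T.dist y'' x + 1 = T.dist y' x := by
          have h8 := hT.dist_eq_dist_add_one_of_adj x ha
          rw [T.dist_comm (u := x), T.dist_comm (u := x)] at h8
          rw [T.dist_comm (u := x)] at hd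
          rw [T.dist_comm (u := x)] at hd
          omega
        have : y = y'' := closer_neighbour_unique hT hyy'.symm ha h2.symm h7
        subst this
        omega

theorem apply_mem_halfTree_iff (g : T ≃g T) {v w x : V} :
    g x ∈ halfTree T (g v) (g w) ↔ x ∈ halfTree T v w := by
  simp [halfTree, dist_map_iso]

theorem mem_halfTree_apply_iff (g : T ≃g T) {v w x : V} :
    x ∈ halfTree T (g v) (g w) ↔ g⁻¹ x ∈ halfTree T v w := by
  rw [← apply_mem_halfTree_iff g (x := g⁻¹ x), RelIso.apply_inv_self]

theorem adj_apply (g : T ≃g T) {v w : V} (h : T.Adj v w) : T.Adj (g v) (g w) :=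
  g.map_adj_iff.2 h

/-- Two half-trees whose roots lie in neither of them are disjoint or share their root. -/
theorem root_eq_of_mem_inter (hT : T.IsTree) {a b c d x : V} (hab : T.Adj a b) (hcd : T.Adj c d)
    (hc : c ∉ halfTree T a b) (ha : a ∉ halfTree T c d)
    (hx : x ∈ halfTree T a b) (hx' : x ∈ halfTree T c d) : a = c := by
  have h1 := dist_eq_of_mem_halfTree hT hab hx hc
  have h2 := dist_eq_of_mem_halfTree hT hcd hx' ha
  have := T.dist_comm (u := a) (v := c)
  exact (hT.connected.dist_eq_zero_iff).1 (by omega)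

theorem eq_of_mem_halfTree_of_same_root (hT : T.IsTree) {a b d x : V} (hab : T.Adj a b)
    (had : T.Adj a d) (hx : x ∈ halfTree T a b) (hx' : x ∈ halfTree T a d) : b = d := by
  refine closer_neighbour_unique hT (z := x) hab had ?_ ?_
  · rw [T.dist_comm, ← dist_of_mem_halfTree hT hab hx, T.dist_comm]
  · rw [T.dist_comm, ← dist_of_mem_halfTree hT had hx', T.dist_comm]

/-- The four relative positions of two half-trees. -/
theorem halfTree_cases (hT : T.IsTree) {a b c d : V} (hab : T.Adj a b) (hcd : T.Adj c d) :
    (∀ x ∈ halfTree T a b, x ∈ halfTree T c d) ∨ (∀ x ∈ halfTree T c d, x ∈ halfTree T a b) ∨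
      (∀ x ∈ halfTree T a b, x ∉ halfTree T c d) ∨
      (∀ x, x ∉ halfTree T a b → x ∈ halfTree T c d) := by
  -- Which alternative holds is decided by which half-tree contains the root of the other; if
  -- neither does, they are disjoint or equal.
  by_cases hc : c ∈ halfTree T a b <;> by_cases ha : a ∈ halfTree T c d
  · refine Or.inr (Or.inr (Or.inr fun x hx => ?_))
    by_contra hx'
    have h1 := dist_eq_of_mem_halfTree hT hab hc hx
    have h2 := dist_eq_of_mem_halfTree hT hcd ha hx'
    have := T.dist_comm (u := a) (v := c)
    have : a = c := (hT.connected.dist_eq_zero_iff).1 (by omega)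
    subst this
    exact left_notMem_halfTree hc
  · refine Or.inr (Or.inl fun x hx => ?_)
    by_contra hx'
    have h1 := dist_eq_of_mem_halfTree hT hab hc hx'
    have h2 := dist_eq_of_mem_halfTree hT hcd hx ha
    have := T.dist_comm (u := a) (v := c)
    have := T.dist_comm (u := a) (v := x)
    have := T.dist_comm (u := c) (v := x)
    have : a = c := (hT.connected.dist_eq_zero_iff).1 (by omega)
    subst this
    exact left_notMem_halfTree hc
  · refine Or.inl fun x hx => ?_
    by_contra hx'
    have h1 := dist_eq_of_mem_halfTree hT hab hx hc
    have h2 := dist_eq_of_mem_halfTree hT hcd ha hx'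
    have := T.dist_comm (u := a) (v := c)
    have := T.dist_comm (u := a) (v := x)
    have := T.dist_comm (u := c) (v := x)
    have : a = c := (hT.connected.dist_eq_zero_iff).1 (by omega)
    subst this
    exact left_notMem_halfTree ha
  · by_cases hac : a = c
    · subst hac
      by_cases hbd : b = d
      · subst hbd
        exact Or.inl fun x hx => hx
      · exact Or.inr (Or.inr (Or.inl fun x hx hx' =>
          hbd (eq_of_mem_halfTree_of_same_root hT hab hcd hx hx')))
    · exact Or.inr (Or.inr (Or.inl fun x hx hx' =>
        hac (root_eq_of_mem_inter hT hab hcd hc ha hx hx')))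

/-- A vertex outside a half-tree has a neighbour closer to all of its vertices. -/
theorem exists_closer_neighbour_halfTree (hT : T.IsTree) {v w x : V} (h : T.Adj v w)
    (hx : x ∉ halfTree T v w) :
    ∃ y, T.Adj x y ∧ ∀ z ∈ halfTree T v w, T.dist y z + 1 = T.dist x z := by
  by_cases hxv : x = v
  · subst hxv
    refine ⟨w, h, fun z hz => ?_⟩
    rw [T.dist_comm, ← dist_of_mem_halfTree hT h hz, T.dist_comm]
  · obtain ⟨y, hy, hd⟩ := exists_closer_neighbour hT hxv
    refine ⟨y, hy, fun z hz => ?_⟩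
    have h1 := dist_eq_of_mem_halfTree hT h hz hx
    have h2 := hT.connected.dist_triangle (u := z) (v := v) (w := y)
    have h3 := hT.dist_eq_dist_add_one_of_adj z hy
    rw [T.dist_comm (u := y), T.dist_comm (u := x)] at hd ⊢
    omega

/-! ### Geodesics and infinite paths -/

/-- Vertices of a geodesic are determined by their distance to an end of it. -/
theorem geodesic_point_unique (hT : T.IsTree) {a b x x' : V}
    (h : T.dist a x + T.dist x b = T.dist a b) (h' : T.dist a x' + T.dist x' b = T.dist a b)
    (hd : T.dist a x = T.dist a x') : x = x' := by
  induction hn : T.dist x b generalizing x x' with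
  | zero =>
    rw [(hT.connected.dist_eq_zero_iff).1 hn,
      (hT.connected.dist_eq_zero_iff (u := x') (v := b)).1 (by omega)]
  | succ n ih =>
    have key : ∀ x, T.dist a x + T.dist x b = T.dist a b → T.dist x b = n + 1 →
        ∃ y, T.Adj x y ∧ T.dist a y = T.dist a x + 1 ∧ T.dist y b = n := by
      intro x h hn
      obtain ⟨y, hy, hyd⟩ := exists_closer_neighbour hT (x := x) (z := b) (by
        rintro rfl
        simp at hn)
      have h1 := hT.connected.dist_triangle (u := a) (v := y) (w := b)
      have h2 := hT.dist_eq_dist_add_one_of_adj a hy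
      exact ⟨y, hy, by omega, by omega⟩
    obtain ⟨y, hy, h1, h2⟩ := key x h hn
    obtain ⟨y', hy', h1', h2'⟩ := key x' h' (by omega)
    have : y = y' := ih (by omega) (by omega) (by omega) h2
    subst this
    refine closer_neighbour_unique hT (z := a) hy.symm hy'.symm ?_ ?_
    · rw [T.dist_comm, ← h1, T.dist_comm]
    · rw [T.dist_comm, ← h1', T.dist_comm]

theorem exists_geodesic_point (hT : T.IsTree) {a b : V} {n : ℕ} (hn : n ≤ T.dist a b) :
    ∃ x, T.dist a x = n ∧ T.dist a x + T.dist x b = T.dist a b := by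
  induction n with
  | zero => exact ⟨a, by simp, by simp⟩
  | succ n ih =>
    obtain ⟨x, h1, h2⟩ := ih (by omega)
    obtain ⟨y, hy, hyd⟩ := exists_closer_neighbour hT (x := x) (z := b) (by
      rintro rfl
      simp at h2
      omega)
    have h3 := hT.connected.dist_triangle (u := a) (v := y) (w := b)
    have h4 := hT.dist_eq_dist_add_one_of_adj a hy
    exact ⟨y, by omega, by omega⟩

/-- An automorphism fixing two vertices fixes the geodesic between them. -/
theorem apply_eq_of_geodesic (hT : T.IsTree) (g : T ≃g T) {a b x : V} (ha : g a = a) (hb : g b = b)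
    (h : T.dist a x + T.dist x b = T.dist a b) : g x = x := by
  have h1 : T.dist a (g x) = T.dist a x := by rw [← dist_map_iso g a x, ha]
  have h2 : T.dist (g x) b = T.dist x b := by rw [← dist_map_iso g x b, hb]
  exact geodesic_point_unique hT (by omega) h h1

/-- A sequence lying evenly spaced on a geodesic extends to an infinite path. -/
theorem exists_ray (hT : T.IsTree) (s : ℕ → V) {l : ℕ} (hl : 1 ≤ l)
    (hs : ∀ n, T.dist (s 0) (s n) = n * l) (hs' : ∀ n, T.dist (s n) (s (n + 1)) = l) :
    ∃ r : ℕ → V, IsInfinitePath T r ∧ (∀ n, s n ∈ Set.range r) ∧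
      ∀ n m, n ≤ m → T.dist (s 0) (r n) + T.dist (r n) (s m) = T.dist (s 0) (s m) := by
  have hle : ∀ n, n ≤ T.dist (s 0) (s n) := fun n => by
    rw [hs]
    exact Nat.le_mul_of_pos_right n hl
  -- `r n` is the point at distance `n` from `s 0` on the geodesic to `s n`, which is long enough
  -- since `l ≥ 1`; so `s n` will be `r (n * l)`.
  choose r hr hr' using fun n => exists_geodesic_point hT (hle n)
  have hext : ∀ x n, T.dist (s 0) x + T.dist x (s n) = T.dist (s 0) (s n) → ∀ m, n ≤ m →
      T.dist (s 0) x + T.dist x (s m) = T.dist (s 0) (s m) := by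
    intro x n h m hnm
    induction m, hnm using Nat.le_induction with
    | base => exact h
    | succ m _ ih =>
      have h1 := hT.connected.dist_triangle (u := s 0) (v := x) (w := s (m + 1))
      have h2 := hT.connected.dist_triangle (u := x) (v := s m) (w := s (m + 1))
      have h3 := hs m
      have h4 := hs (m + 1)
      have h5 := hs' m
      rw [add_mul, one_mul] at h4
      omega
  have hgeo := fun n => hext (r n) n (hr' n)
  refine ⟨r, fun n => ⟨?_, fun h => ?_⟩, fun n => ⟨n * l, ?_⟩, hgeo⟩
  · have h1 := hgeo n (n + 1) (by omega)
    have h2 := hr' (n + 1)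
    rw [hr] at h1 h2
    obtain ⟨y, hy, hyd⟩ := exists_closer_neighbour hT (x := r n) (z := s (n + 1)) (by
      intro h
      rw [h] at h1
      have := hle (n + 1)
      simp at h1
      omega)
    have h3 := hT.connected.dist_triangle (u := s 0) (v := y) (w := s (n + 1))
    have h4 := hT.dist_eq_dist_add_one_of_adj (s 0) hy
    rw [hr] at h4
    have : y = r (n + 1) := geodesic_point_unique hT (a := s 0) (b := s (n + 1)) (by omega)
      (hr' (n + 1)) (by rw [hr]; omega)
    rwa [← this]
  · have h1 := hr n
    rw [h, hr] at h1
    omega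
  · refine geodesic_point_unique hT (hgeo (n * l) (n * l) le_rfl) (b := s (n * l)) ?_
      (by rw [hr, hs])
    exact hext (s n) n (by simp) _ (Nat.le_mul_of_pos_right n hl)

theorem IsInfinitePath.shift {r : ℕ → V} (hr : IsInfinitePath T r) (m : ℕ) :
    IsInfinitePath T fun n => r (m + n) := fun n => hr (m + n)

theorem IsInfinitePath.dist_zero (hT : T.IsTree) {r : ℕ → V} (hr : IsInfinitePath T r) (n : ℕ) :
    T.dist (r 0) (r n) = n ∧ T.dist (r 0) (r (n + 1)) = n + 1 := by
  induction n with
  | zero => simpa using SimpleGraph.dist_eq_one_iff_adj.2 (hr 0).1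
  | succ n ih =>
    refine ⟨ih.2, ?_⟩
    have h : T.dist (r 0) (r (n + 1)) = T.dist (r 0) (r (n + 2)) + 1 ∨
        T.dist (r 0) (r (n + 2)) = T.dist (r 0) (r (n + 1)) + 1 :=
      hT.dist_eq_dist_add_one_of_adj (r 0) (hr (n + 1)).1
    change T.dist (r 0) (r (n + 2)) = n + 1 + 1
    by_contra hne
    refine (hr n).2 (closer_neighbour_unique hT (z := r 0) (hr n).1.symm (hr (n + 1)).1 ?_ ?_) <;>
      rw [T.dist_comm, T.dist_comm (v := r 0)] <;> omega

theorem IsInfinitePath.injective (hT : T.IsTree) {r : ℕ → V} (hr : IsInfinitePath T r) :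
    Function.Injective r := by
  have key : ∀ m n, m ≤ n → r m = r n → m = n := by
    intro m n hmn h
    have := ((hr.shift m).dist_zero hT (n - m)).1
    rw [Nat.add_sub_cancel' hmn, add_zero, h, T.dist_self] at this
    omega
  intro m n h
  rcases le_total m n with hmn | hmn
  · exact key m n hmn h
  · exact (key n m hmn h.symm).symm

/-! ### Flows and stabilised ends -/

/-- A map sending each vertex to the next one on the way to an end of the tree. -/
structure IsFlow (T : SimpleGraph V) (σ : V → V) : Prop where
  adj : ∀ x, T.Adj x (σ x)
  apply_apply_ne : ∀ x, σ (σ x) ≠ x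
  eq_or_eq : ∀ x y, T.Adj x y → σ x = y ∨ σ y = x

theorem IsFlow.isInfinitePath {σ : V → V} (hσ : IsFlow T σ) {s : ℕ → V}
    (hs : ∀ n, s (n + 1) = σ (s n)) : IsInfinitePath T s := fun n => by
  rw [hs (n + 1), hs n]
  exact ⟨hσ.adj _, (hσ.apply_apply_ne _).symm⟩

theorem eq_iterate {σ : V → V} {s : ℕ → V} (hs : ∀ n, s (n + 1) = σ (s n)) (m n : ℕ) :
    s (m + n) = σ^[n] (s m) := by
  induction n with
  | zero => rfl
  | succ n ih => rw [← add_assoc, hs, ih, Function.iterate_succ_apply']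

/-- After one step against the flow, the flow points back along the path, so a step along it would
backtrack. -/
theorem IsFlow.toward_or_away {σ : V → V} (hσ : IsFlow T σ) {s : ℕ → V}
    (hs : IsInfinitePath T s) :
    (∀ n, s (n + 1) = σ (s n)) ∨ ∃ N, ∀ n, N ≤ n → σ (s (n + 1)) = s n := by
  by_contra! h
  obtain ⟨⟨N, hN⟩, h⟩ := h
  obtain ⟨n, hn, hne⟩ := h N
  refine hne ?_
  induction n, hn using Nat.le_induction with
  | base => exact (hσ.eq_or_eq _ _ (hs N).1).resolve_left fun h => hN h.symm
  | succ n _ ih =>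
    refine (hσ.eq_or_eq _ _ (hs (n + 1)).1).resolve_left fun h => ?_
    by_cases h' : σ (s (n + 1)) = s n
    · exact (hs n).2 (h'.symm.trans h)
    · exact h' (ih h')

/-- A path running against the flow inside an orbit lowers its index in that orbit at every step,
which cannot go on forever. -/
theorem IsFlow.toward_of_range_subset (hT : T.IsTree) {σ : V → V} (hσ : IsFlow T σ) {r t : ℕ → V}
    (hr : ∀ n, r (n + 1) = σ (r n)) (ht : IsInfinitePath T t) (h : Set.range t ⊆ Set.range r) :
    ∀ n, t (n + 1) = σ (t n) := by
  refine (hσ.toward_or_away ht).resolve_right fun ⟨N, hN⟩ => ?_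
  choose φ hφ using fun n => h ⟨n, rfl⟩
  have hstep : ∀ m, φ (N + m) + m = φ N := by
    intro m
    induction m with
    | zero => rfl
    | succ m ih =>
      have h1 := hN (N + m) (by omega)
      rw [← hφ, ← hφ (N + m), ← hr] at h1
      have h2 := (hσ.isInfinitePath hr).injective hT h1
      change φ (N + m + 1) + (m + 1) = φ N
      omega
  have := hstep (φ N + 1)
  omega

theorem IsFlow.toward_of_subset_range (hT : T.IsTree) {σ : V → V} (hσ : IsFlow T σ) {s t : ℕ → V}
    (ht : ∀ n, t (n + 1) = σ (t n)) (hs : IsInfinitePath T s) (h : Set.range t ⊆ Set.range s) :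
    ∀ n, s (n + 1) = σ (s n) := by
  refine (hσ.toward_or_away hs).resolve_right fun ⟨N, hN⟩ => ?_
  choose φ hφ using fun n => h ⟨n, rfl⟩
  have hinj : Function.Injective φ := fun m n hmn =>
    (hσ.isInfinitePath ht).injective hT (by rw [← hφ, ← hφ n, hmn])
  -- Being injective, `φ` eventually exceeds `N`. From there on `s` runs against the flow, so
  -- following `t` lowers `φ` by one at each step.
  have hev := hinj.tendsto_cofinite
  rw [Nat.cofinite_eq_atTop] at hev
  obtain ⟨M, hM⟩ := Filter.eventually_atTop.1 (hev.eventually_ge_atTop (N + 1))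
  have hstep : ∀ m, φ (M + m) + m = φ M := by
    intro m
    induction m with
    | zero => rfl
    | succ m ih =>
      have h0 := hM (M + m) (by omega)
      have h1 := hN (φ (M + m) - 1) (by omega)
      rw [Nat.sub_add_cancel (by omega), hφ, ← ht, ← hφ] at h1
      have h2 := hs.injective hT h1
      change φ (M + m + 1) + (m + 1) = φ M
      omega
  have := hstep (φ M + 1)
  omega

theorem IsFlow.exists_iterate_eq (hT : T.IsTree) {σ : V → V} (hσ : IsFlow T σ) (x y : V) :
    ∃ m n, σ^[m] x = σ^[n] y := by
  obtain ⟨p⟩ := hT.connected x y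
  induction p with
  | nil => exact ⟨0, 0, rfl⟩
  | @cons x z y h p ih =>
    obtain ⟨m, n, hmn⟩ := ih
    rcases hσ.eq_or_eq _ _ h with h | h
    · exact ⟨m + 1, n, by rw [Function.iterate_succ_apply, h, hmn]⟩
    · exact ⟨m, n + 1, by rw [← h, ← Function.iterate_succ_apply, Function.iterate_succ_apply',
        hmn, Function.iterate_succ_apply']⟩

theorem IsFlow.sameEnd (hT : T.IsTree) {σ : V → V} (hσ : IsFlow T σ) {s r : ℕ → V}
    (hs : ∀ n, s (n + 1) = σ (s n)) (hr : ∀ n, r (n + 1) = σ (r n)) : SameEnd T s r := by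
  classical
  have hex : ∃ n, s n ∈ Set.range r := by
    obtain ⟨m, n, h⟩ := hσ.exists_iterate_eq hT (s 0) (r 0)
    exact ⟨0 + m, 0 + n, by rw [eq_iterate hs, eq_iterate hr, h]⟩
  refine ⟨fun i => s (Nat.find hex + i), (hσ.isInfinitePath hs).shift _, ?_⟩
  apply Set.Subset.antisymm
  · rintro _ ⟨i, rfl⟩
    refine ⟨⟨_, rfl⟩, ?_⟩
    obtain ⟨m, hm⟩ := Nat.find_spec hex
    exact ⟨m + i, by
      change r (m + i) = s (Nat.find hex + i)
      rw [eq_iterate hs, eq_iterate hr, hm]⟩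
  · rintro _ ⟨⟨n, rfl⟩, hn⟩
    exact ⟨n - Nat.find hex, by
      change s (Nat.find hex + (n - Nat.find hex)) = s n
      rw [Nat.add_sub_cancel' (Nat.find_min' hex hn)]⟩

/-- All orbits of the flow represent one end, and every path representing it follows the flow; maps
commuting with the flow preserve this. -/
theorem IsFlow.stabilisesAnEnd (hT : T.IsTree) {σ : V → V} (hσ : IsFlow T σ)
    {G : Subgroup (T ≃g T)} (hG : ∀ g ∈ G, ∀ x, σ (g x) = g (σ x)) : StabilisesAnEnd G := by
  obtain ⟨x⟩ := hT.connected.nonempty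
  have hr : ∀ n, σ^[n + 1] x = σ (σ^[n] x) := fun n => Function.iterate_succ_apply' σ n x
  refine ⟨fun n => σ^[n] x, hσ.isInfinitePath hr, ?_⟩
  rintro g hg s hs ⟨t, ht, hrange⟩
  have h1 : ∀ n, t (n + 1) = σ (t n) :=
    hσ.toward_of_range_subset hT hr ht (hrange ▸ Set.inter_subset_right)
  have h2 := hσ.toward_of_subset_range hT h1 hs (hrange ▸ Set.inter_subset_left)
  exact hσ.sameEnd hT (fun n => by rw [h2, hG g hg]) hr

/-! ### Moving half-trees off themselves -/

theorem isTree_induce_of_convex (hT : T.IsTree) {S : Set V} (hne : S.Nonempty)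
    (hS : ∀ x ∈ S, ∀ z ∈ S, ∀ y, T.Adj x y → T.dist y z + 1 = T.dist x z → y ∈ S) :
    (T.induce S).IsTree := by
  have key : ∀ n, ∀ x z : S, T.dist x.1 z.1 = n → (T.induce S).Reachable x z := by
    intro n
    induction n with
    | zero =>
      intro x z h
      rw [Subtype.ext ((hT.connected.dist_eq_zero_iff).1 h)]
    | succ n ih =>
      intro x z h
      obtain ⟨y, hy, hyd⟩ := exists_closer_neighbour hT (x := x.1) (z := z.1) (by
        intro h'
        rw [h', T.dist_self] at h
        omega)
      have hyS := hS x.1 x.2 z.1 z.2 y hy hyd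
      have hadj : (T.induce S).Adj x ⟨y, hyS⟩ := hy
      exact hadj.reachable.trans (ih ⟨y, hyS⟩ z (by change T.dist y z.1 = n; omega))
  have : Nonempty S := hne.to_subtype
  exact ⟨SimpleGraph.Connected.mk fun x z => key _ x z rfl, hT.isAcyclic.induce S⟩

theorem halfTree_convex (hT : T.IsTree) {v w x y z : V} (h : T.Adj v w)
    (hx : x ∈ halfTree T v w) (hz : z ∈ halfTree T v w) (hxy : T.Adj x y)
    (hd : T.dist y z + 1 = T.dist x z) : y ∈ halfTree T v w := by
  by_contra hy
  have h1 := dist_eq_of_mem_halfTree hT h hx hy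
  have h2 := dist_eq_of_mem_halfTree hT h hz hy
  have h3 := SimpleGraph.dist_eq_one_iff_adj.2 hxy
  have h4 := hT.connected.dist_triangle (u := x) (v := v) (w := z)
  have h5 := dist_of_mem_halfTree hT h hx
  have h6 := dist_of_mem_halfTree hT h hz
  have h7 := hT.connected.dist_triangle (u := x) (v := w) (w := z)
  rw [T.dist_comm (u := z)] at h2
  rw [T.dist_comm (u := z)] at h2
  rw [T.dist_comm (u := z), T.dist_comm (u := z)] at h6
  omega

/-- Every half-tree is moved off itself by some element of `Γ`. -/
def Flips (Γ : Subgroup (T ≃g T)) : Prop :=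
  ∀ v w, T.Adj v w → ∃ g ∈ Γ, ∀ x ∈ halfTree T v w, g x ∉ halfTree T v w

theorem flips_of_minimal (hT : T.IsTree) {G : Subgroup (T ≃g T)}
    (hsub : ¬ StabilisesAProperSubtree G) (hend : ¬ StabilisesAnEnd G) : Flips G := by
  intro v w hvw
  by_contra! hmeet
  have hmeet' : ∀ g ∈ G, ∀ g' ∈ G,
      ∃ z, z ∈ halfTree T (g v) (g w) ∧ z ∈ halfTree T (g' v) (g' w) := by
    intro g hg g' hg'
    obtain ⟨x, hx, hx'⟩ := hmeet (g'⁻¹ * g) (G.mul_mem (G.inv_mem hg') hg)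
    rw [RelIso.mul_apply] at hx'
    exact ⟨g x, (apply_mem_halfTree_iff g).2 hx, (mem_halfTree_apply_iff g').2 hx'⟩
  have hadj : ∀ g : T ≃g T, T.Adj (g v) (g w) := fun g => adj_apply g hvw
  by_cases hemp : ∃ x, ∀ g ∈ G, x ∈ halfTree T (g v) (g w)
  · refine hsub ⟨{x | ∀ g ∈ G, x ∈ halfTree T (g v) (g w)},
      isTree_induce_of_convex hT hemp ?_, ?_, ?_⟩
    · intro x hx z hz y hxy hd g hg
      exact halfTree_convex hT (hadj g) (hx g hg) (hz g hg) hxy hd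
    · intro h
      have hv : v ∈ {x | ∀ g ∈ G, x ∈ halfTree T (g v) (g w)} := h ▸ Set.mem_univ v
      exact left_notMem_halfTree (hv 1 G.one_mem)
    · have key : ∀ g ∈ G, ∀ x, (∀ g ∈ G, x ∈ halfTree T (g v) (g w)) →
          ∀ g' ∈ G, g x ∈ halfTree T (g' v) (g' w) := by
        intro g hg x hx g' hg'
        have := (apply_mem_halfTree_iff g).2 (hx (g⁻¹ * g') (G.mul_mem (G.inv_mem hg) hg'))
        simpa only [RelIso.mul_apply, RelIso.apply_inv_self] using this
      intro g hg
      apply Set.Subset.antisymm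
      · rintro _ ⟨x, hx, rfl⟩
        exact key g hg x hx
      · intro x hx
        exact ⟨g⁻¹ x, key g⁻¹ (G.inv_mem hg) x hx, RelIso.apply_inv_self g x⟩
  · push Not at hemp
    choose γ hγ hγx using hemp
    choose σ hσ hσd using fun x => exists_closer_neighbour_halfTree hT (hadj (γ x)) (hγx x)
    -- Each flow axiom, and equivariance, compares steps towards two translates; both steps approach
    -- a vertex `z` common to the two.
    refine hend (IsFlow.stabilisesAnEnd hT (σ := σ) ⟨hσ, ?_, ?_⟩ ?_)
    · intro x h
      obtain ⟨z, hz, hz'⟩ := hmeet' (γ x) (hγ x) (γ (σ x)) (hγ _)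
      have h1 := hσd x z hz
      have h2 := hσd (σ x) z hz'
      rw [h] at h2
      omega
    · intro x y hxy
      obtain ⟨z, hz, hz'⟩ := hmeet' (γ x) (hγ x) (γ y) (hγ y)
      have h1 := hσd x z hz
      have h2 := hσd y z hz'
      have h3 := hT.dist_eq_dist_add_one_of_adj z hxy
      rw [T.dist_comm, T.dist_comm (u := z)] at h3
      rcases h3 with h3 | h3
      · exact Or.inl (closer_neighbour_unique hT (hσ x) hxy h1 h3.symm)
      · exact Or.inr (closer_neighbour_unique hT (hσ y) hxy.symm h2 h3.symm)
    · intro g hg x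
      obtain ⟨z, hz, hz'⟩ := hmeet' (γ (g x)) (hγ _) (g * γ x) (G.mul_mem hg (hγ x))
      refine closer_neighbour_unique hT (z := z) (hσ (g x)) (adj_apply g (hσ x)) (hσd _ z hz) ?_
      rw [RelIso.mul_apply, RelIso.mul_apply, mem_halfTree_apply_iff] at hz'
      have := hσd x _ hz'
      rwa [← dist_map_iso g, ← dist_map_iso g x, RelIso.apply_inv_self] at this

/-- Moving a half-tree off itself puts it into its complement, and `f'` puts the complement of the
target into the target. In each relative position `1`, `f`, `f'` or `f' * f` works. -/
theorem Flips.exists_map_subset (hT : T.IsTree) {Γ : Subgroup (T ≃g T)} (hΓ : Flips Γ)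
    {a b c d : V} (hab : T.Adj a b) (hcd : T.Adj c d) :
    ∃ g ∈ Γ, ∀ x ∈ halfTree T a b, g x ∈ halfTree T c d := by
  obtain ⟨f, hf, hfx⟩ := hΓ a b hab
  obtain ⟨f', hf', hfx'⟩ := hΓ d c hcd.symm
  have hfx'' : ∀ x, x ∉ halfTree T c d → f' x ∈ halfTree T c d := fun x hx =>
    (notMem_halfTree hT hcd.symm).1 (hfx' x ((notMem_halfTree hT hcd).1 hx))
  rcases halfTree_cases hT hab hcd with h | h | h | h
  · exact ⟨1, Γ.one_mem, h⟩
  · exact ⟨f' * f, Γ.mul_mem hf' hf, fun x hx => hfx'' _ fun h' => hfx x hx (h _ h')⟩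
  · exact ⟨f', hf', fun x hx => hfx'' x (h x hx)⟩
  · exact ⟨f, hf, fun x hx => h _ (hfx x hx)⟩

theorem Flips.of_normalised (hT : T.IsTree) {Γ N : Subgroup (T ≃g T)} (hΓ : Flips Γ)
    (hN : ∀ g ∈ Γ, ∀ n ∈ N, g * n * g⁻¹ ∈ N) {n : T ≃g T} (hn : n ∈ N) {a b : V}
    (hab : T.Adj a b) (hnab : ∀ x ∈ halfTree T a b, n x ∉ halfTree T a b) : Flips N := by
  intro v w hvw
  obtain ⟨f, hf, hfx⟩ := hΓ.exists_map_subset hT hvw hab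
  refine ⟨f⁻¹ * n * f⁻¹⁻¹, hN _ (Γ.inv_mem hf) n hn, fun x hx h => hnab _ (hfx x hx) ?_⟩
  have := hfx _ h
  rwa [inv_inv, RelIso.mul_apply, RelIso.mul_apply, RelIso.apply_inv_self] at this

/-! ### Branch vertices -/

/-- `u` has at least three neighbours. -/
def IsBranch (T : SimpleGraph V) (u : V) : Prop :=
  ∃ a b c, T.Adj u a ∧ T.Adj u b ∧ T.Adj u c ∧ a ≠ b ∧ a ≠ c ∧ b ≠ c

theorem IsBranch.apply {u : V} (hu : IsBranch T u) (g : T ≃g T) : IsBranch T (g u) := by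
  obtain ⟨a, b, c, ha, hb, hc, hab, hac, hbc⟩ := hu
  exact ⟨g a, g b, g c, adj_apply g ha, adj_apply g hb, adj_apply g hc, g.injective.ne hab,
    g.injective.ne hac, g.injective.ne hbc⟩

theorem IsBranch.exists_two (hT : T.IsTree) {u : V} (hu : IsBranch T u) (x : V) :
    ∃ a b, T.Adj u a ∧ T.Adj u b ∧ a ≠ b ∧ x ∉ halfTree T u a ∧ x ∉ halfTree T u b := by
  obtain ⟨a, b, c, ha, hb, hc, hab, hac, hbc⟩ := hu
  by_cases h : x ∈ halfTree T u a
  · exact ⟨b, c, hb, hc, hbc,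
      fun h' => hab (eq_of_mem_halfTree_of_same_root hT ha hb h h'),
      fun h' => hac (eq_of_mem_halfTree_of_same_root hT ha hc h h')⟩
  · by_cases h' : x ∈ halfTree T u b
    · exact ⟨a, c, ha, hc, hac, h,
        fun h'' => hbc (eq_of_mem_halfTree_of_same_root hT hb hc h' h'')⟩
    · exact ⟨a, b, ha, hb, hab, h, h'⟩

theorem IsBranch.exists_avoiding (hT : T.IsTree) {u : V} (hu : IsBranch T u) (x x' : V) :
    ∃ a, T.Adj u a ∧ x ∉ halfTree T u a ∧ x' ∉ halfTree T u a := by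
  obtain ⟨a, b, ha, hb, hab, hxa, hxb⟩ := hu.exists_two hT x
  by_cases h : x' ∈ halfTree T u a
  · exact ⟨b, hb, hxb, fun h' => hab (eq_of_mem_halfTree_of_same_root hT ha hb h h')⟩
  · exact ⟨a, ha, hxa, h⟩

/-- Take a moved vertex `y` nearest to `v` and its neighbour `u` towards `v`. Then `u` is fixed and
has the distinct neighbours `y`, `g y` and a fixed one; `g` carries the branch at `y` to the
disjoint branch at `g y`. -/
theorem exists_isBranch_of_fixes_edge (hT : T.IsTree) {g : T ≃g T} (hg : g ≠ 1) {v w : V}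
    (hvw : T.Adj v w) (hv : g v = v) (hw : g w = w) :
    ∃ u y, IsBranch T u ∧ T.Adj u y ∧ ∀ x ∈ halfTree T u y, g x ∉ halfTree T u y := by
  classical
  have hex : ∃ n x, T.dist x v = n ∧ g x ≠ x := by
    by_contra! h
    exact hg (RelIso.ext fun x => h _ x rfl)
  obtain ⟨y, hyn, hy⟩ := Nat.find_spec hex
  have hfix : ∀ x, T.dist x v < T.dist y v → g x = x := by
    intro x hx
    by_contra h
    exact Nat.find_min hex (hyn ▸ hx) ⟨x, rfl, h⟩
  obtain ⟨u, hyu, hu⟩ := exists_closer_neighbour hT (x := y) (z := v) (by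
    rintro rfl
    exact hy hv)
  have hgu : g u = u := hfix u (by omega)
  have hugy : T.Adj u (g y) := by
    have := adj_apply g hyu.symm
    rwa [hgu] at this
  have hne : ∀ p, g p = p → y ≠ p ∧ g y ≠ p := by
    rintro p hp
    refine ⟨?_, fun h => ?_⟩
    · rintro rfl
      exact hy hp
    · rw [← hp] at h
      have := g.injective h
      rw [this] at hy
      exact hy hp
  have hthird : ∃ p, T.Adj u p ∧ g p = p := by
    by_cases huv : u = v
    · subst huv
      exact ⟨w, hvw, hw⟩
    · obtain ⟨p, hp, hpd⟩ := exists_closer_neighbour hT huv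
      exact ⟨p, hp, hfix p (by omega)⟩
  obtain ⟨p, hup, hp⟩ := hthird
  refine ⟨u, y, ⟨y, g y, p, hyu.symm, hugy, hup, Ne.symm hy, (hne p hp).1, (hne p hp).2⟩,
    hyu.symm, fun x hx hx' => ?_⟩
  have h1 := (apply_mem_halfTree_iff g).2 hx
  rw [hgu] at h1
  exact hy (eq_of_mem_halfTree_of_same_root hT hugy hyu.symm h1 hx')

theorem Flips.exists_isBranch_mem (hT : T.IsTree) {Γ : Subgroup (T ≃g T)} (hΓ : Flips Γ)
    {u : V} (hu : IsBranch T u) {v w : V} (hvw : T.Adj v w) :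
    ∃ x ∈ halfTree T v w, IsBranch T x := by
  obtain ⟨a, -, -, ha, -⟩ := id hu
  obtain ⟨f, -, hf⟩ := hΓ.exists_map_subset hT ha.symm hvw
  exact ⟨f u, hf u (right_mem_halfTree ha.symm), hu.apply f⟩

/-- A nontrivial group normalised by a flipping group is flipping, if the tree branches. -/
theorem Flips.of_ne_bot (hT : T.IsTree) {Γ N : Subgroup (T ≃g T)} (hΓ : Flips Γ)
    {u : V} (hu : IsBranch T u) (hN : ∀ g ∈ Γ, ∀ n ∈ N, g * n * g⁻¹ ∈ N) (hne : N ≠ ⊥) :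
    Flips N := by
  obtain ⟨h, hh, h1⟩ := N.bot_or_exists_ne_one.resolve_left hne
  -- Branch vertices occur on both sides of every edge, so each vertex lies on a geodesic between
  -- two of them; fixing all of them forces `h = 1`.
  have hmove : ∃ p, IsBranch T p ∧ h p ≠ p := by
    by_contra! hfix
    refine h1 (RelIso.ext fun x => ?_)
    have hnb : ∃ y, T.Adj x y := by
      by_cases hxu : x = u
      · obtain ⟨a, -, -, ha, -⟩ := id hu
        exact ⟨a, hxu ▸ ha⟩
      · exact (exists_closer_neighbour hT hxu).imp fun _ h => h.1
    obtain ⟨y, hxy⟩ := hnb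
    obtain ⟨p, hp, hpb⟩ := hΓ.exists_isBranch_mem hT hu hxy
    obtain ⟨q, hq, hqb⟩ := hΓ.exists_isBranch_mem hT hu hxy.symm
    exact apply_eq_of_geodesic hT _ (hfix p hpb) (hfix q hqb)
      (dist_eq_of_mem_halfTree hT hxy hp ((notMem_halfTree hT hxy).2 hq)).symm
  obtain ⟨p, hpb, hp⟩ := hmove
  -- With `h p` and `h⁻¹ p` both avoided, neither this half-tree nor its image contains the other's
  -- root; as `h p ≠ p`, the two are disjoint.
  obtain ⟨a, ha, ha1, ha2⟩ := hpb.exists_avoiding hT (h p) (h⁻¹ p)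
  refine hΓ.of_normalised hT hN hh ha fun x hx hx' => hp ?_
  exact (root_eq_of_mem_inter hT ha (adj_apply h ha) ha1
    (fun h' => ha2 ((mem_halfTree_apply_iff _).1 h')) hx' ((apply_mem_halfTree_iff _).2 hx)).symm

/-! ### Property `P_k` and the commutator argument -/

/-- Under Property `P_k`, elements of `Fix_G(C^{k-1})` can be prescribed independently on the
fibres over `C`. -/
theorem PropertyP.exists_glue {k : ℕ} {G : Subgroup (T ≃g T)} (hP : PropertyP k G) {C : Set V}
    (hC : IsPathSet T C) (γ : C → fixator G (nbhd T C (k - 1))) :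
    ∃ f ∈ fixator G (nbhd T C (k - 1)), ∀ x : C, ∀ z ∈ fibre T C x, f z = (γ x).1 z := by
  obtain ⟨f, hf⟩ := (hP C hC).2 fun x => (fibreAction G C (k - 1) x).rangeRestrict (γ x)
  refine ⟨f.1, f.2, fun x z hz => ?_⟩
  have h1 := congrArg Subtype.val (congrFun hf x)
  exact congrArg Subtype.val (congrArg (fun e : Equiv.Perm _ => e ⟨z, hz⟩) h1)

theorem exists_mem_fibre {C : Set V} (hC : C.Nonempty) (z : V) : ∃ x ∈ C, z ∈ fibre T C x := by
  classical
  have hex : ∃ n, ∃ x ∈ C, T.dist z x = n := ⟨_, hC.some, hC.some_mem, rfl⟩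
  obtain ⟨x, hx, hn⟩ := Nat.find_spec hex
  exact ⟨x, hx, fun y hy => hn ▸ Nat.find_min' hex ⟨y, hy, rfl⟩⟩

/-- The distances from a vertex to `a` and `b` differ by one, so if both are at most `k`, the
smaller is at most `k - 1`. -/
theorem mem_plus_of_mem_fixator_nbhd (hT : T.IsTree) {k : ℕ} {G : Subgroup (T ≃g T)} {C : Set V}
    {f : T ≃g T} (hf : f ∈ fixator G (nbhd T C (k - 1))) {a b : V} (ha : a ∈ C) (hb : b ∈ C)
    (hab : T.Adj a b) : f ∈ plus k G := by
  refine Subgroup.subset_closure ⟨a, b, hab, hf.1, fun z hz => hf.2 z ?_⟩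
  have h1 : T.dist a z ≤ k := hz.1
  have h2 : T.dist b z ≤ k := hz.2
  have h3 := hT.dist_eq_dist_add_one_of_adj z hab
  rw [T.dist_comm] at h1 h2
  by_cases h : T.dist z a ≤ k - 1
  · exact ⟨a, ha, h⟩
  · exact ⟨b, hb, by omega⟩

/-- A translation whose axis avoids the support of `g` exhibits `g` as a commutator. -/
theorem mem_of_fixes_halfTree (hT : T.IsTree) {k : ℕ} {G H : Subgroup (T ≃g T)}
    (hP : PropertyP k G) (hHG : H ≤ G) (hflip : Flips H)
    (hH : ∀ g ∈ plus k G, ∀ h ∈ H, g * h * g⁻¹ ∈ H) {u₀ : V} (hu₀ : IsBranch T u₀)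
    {g : T ≃g T} {v w : V} (hvw : T.Adj v w) (hg : g ∈ fixator G (nbhd T {v, w} (k - 1)))
    (hfix : ∀ z, z ∉ halfTree T v w → g z = z) : g ∈ H := by
  obtain ⟨u, hu, hub⟩ := hflip.exists_isBranch_mem hT hu₀ hvw.symm
  replace hu := (notMem_halfTree hT hvw).2 hu
  obtain ⟨a, b, hua, hub', hab, hwa, hwb⟩ := hub.exists_two hT w
  have hdisj : ∀ y, T.Adj u y → w ∉ halfTree T u y → ∀ z ∈ halfTree T v w,
      z ∉ halfTree T u y := by
    intro y hy hwy z hz hzy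
    have h1 := dist_eq_of_mem_halfTree hT hy hzy hwy
    have h2 := dist_eq_of_mem_halfTree hT hvw hz hu
    have h3 := dist_of_mem_halfTree hT hvw hz
    omega
  -- `h` pushes everything outside the `b`-branch at `u` into the `a`-branch, so it translates along
  -- an axis through `u` that avoids the side of `w`.
  obtain ⟨h, hh, hmap⟩ := hflip.exists_map_subset hT hub'.symm hua
  have hsub : ∀ x ∈ halfTree T u a, x ∈ halfTree T b u := fun x hx =>
    (notMem_halfTree hT hub').1 fun h' => hab (eq_of_mem_halfTree_of_same_root hT hua hub' hx h')
  have hpow : ∀ i : ℕ, ∀ x ∈ halfTree T b u, (h ^ (i + 1)) x ∈ halfTree T u a := by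
    intro i
    induction i with
    | zero => simpa using hmap
    | succ i ih =>
      intro x hx
      rw [pow_succ', RelIso.mul_apply]
      exact hmap _ (hsub _ (ih x hx))
  have huE : u ∈ halfTree T b u := right_mem_halfTree hub'.symm
  have hBE : ∀ x ∈ halfTree T v w, x ∈ halfTree T b u := fun x hx =>
    (notMem_halfTree hT hub').1 (hdisj b hub' hwb x hx)
  have hback : ∀ i : ℕ, (h ^ (i + 1))⁻¹ u ∈ halfTree T u b := by
    intro i
    by_contra h'
    have := hpow i _ ((notMem_halfTree hT hub').1 h')
    rw [RelIso.apply_inv_self] at this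
    exact left_notMem_halfTree this
  -- the orbit of `u` is evenly spaced on a geodesic
  have hl : 1 ≤ T.dist u (h u) := hT.connected.pos_dist_of_ne fun h' => by
    have := hmap u huE
    rw [← h'] at this
    exact left_notMem_halfTree this
  have hstep : ∀ n : ℕ, T.dist ((h ^ n) u) ((h ^ (n + 1)) u) = T.dist u (h u) := fun n => by
    rw [pow_succ, RelIso.mul_apply, dist_map_iso]
  have hdist : ∀ n : ℕ, T.dist ((h ^ 0) u) ((h ^ n) u) = n * T.dist u (h u) := by
    intro n
    induction n with
    | zero => simp
    | succ n ih =>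
      rcases n with _ | n
      · simp
      · have h1 : (h ^ (n + 1 + 1)) u ∈ halfTree T (h u) (h a) := by
          rw [pow_succ', RelIso.mul_apply]
          exact (apply_mem_halfTree_iff h).2 (hpow n u huE)
        have h2 : u ∉ halfTree T (h u) (h a) := fun h' => by
          have := hmap _ (hsub _ ((mem_halfTree_apply_iff h).1 h'))
          rw [RelIso.apply_inv_self] at this
          exact left_notMem_halfTree this
        have h3 := dist_eq_of_mem_halfTree hT (adj_apply h hua) h1 h2
        rw [T.dist_comm (v := h u), T.dist_comm (v := u), T.dist_comm (v := u)] at h3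
        have h4 : T.dist (h u) ((h ^ (n + 1 + 1)) u) = T.dist u ((h ^ (n + 1)) u) := by
          rw [pow_succ' h (n + 1), RelIso.mul_apply, dist_map_iso]
        have h5 : T.dist u ((h ^ (n + 1)) u) = (n + 1) * T.dist u (h u) := ih
        change T.dist u ((h ^ (n + 1 + 1)) u) = (n + 1 + 1) * T.dist u (h u)
        rw [h3, h4, h5]
        ring
  obtain ⟨r, hr, hrs, hgeo⟩ := exists_ray hT (fun n : ℕ => (h ^ n) u) hl hdist hstep
  set C : Set V := Set.range r
  -- position of the ray relative to the translates of the two half-trees at `u`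
  have hpos : ∀ (i : ℕ), ∀ y ∈ C, (h ^ i)⁻¹ y ∈ halfTree T u a ∨ (h ^ i)⁻¹ y = u ∨
      (h ^ i)⁻¹ y ∈ halfTree T u b := by
    rintro i _ ⟨n, rfl⟩
    -- Otherwise `u` separates `(h ^ i)⁻¹ (r n)` from both `(h ^ (n + 1)) u` and `(h ^ i)⁻¹ u`,
    -- while `hgeo` puts it on the geodesic between these two; so it is `u`.
    by_contra! hcon
    obtain ⟨h1, h2, h3⟩ := hcon
    have h4 := hgeo n (i + (n + 1)) (by omega)
    have h5 := dist_eq_of_mem_halfTree hT hua (hpow n u huE) h1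
    have h6 : T.dist u ((h ^ i)⁻¹ (r n)) + T.dist u ((h ^ i)⁻¹ u) =
        T.dist ((h ^ i)⁻¹ u) ((h ^ i)⁻¹ (r n)) := by
      rcases i with _ | i
      · simp
      · have := dist_eq_of_mem_halfTree hT hub' (hback i) h3
        rw [T.dist_comm (v := u)] at this
        omega
    have h7 := hT.connected.dist_triangle (u := (h ^ i)⁻¹ u) (v := u) (w := (h ^ (n + 1)) u)
    have h8 : (h ^ (i + (n + 1))) u = (h ^ i) ((h ^ (n + 1)) u) := by
      rw [pow_add, RelIso.mul_apply]
    change T.dist u (r n) + T.dist (r n) ((h ^ (i + (n + 1))) u) =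
      T.dist u ((h ^ (i + (n + 1))) u) at h4
    rw [h8, ← dist_map_iso (h ^ i)⁻¹ u (r n), ← dist_map_iso (h ^ i)⁻¹ (r n),
      ← dist_map_iso (h ^ i)⁻¹ u ((h ^ i) _), RelIso.inv_apply_self] at h4
    have h9 := T.dist_comm (u := (h ^ (n + 1)) u) (v := u)
    have h10 := T.dist_comm (u := (h ^ (n + 1)) u) (v := (h ^ i)⁻¹ (r n))
    have h11 := T.dist_comm (u := u) (v := (h ^ i)⁻¹ u)
    exact h2 ((hT.connected.dist_eq_zero_iff (u := u)).1 (by omega)).symm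
  have hCB : ∀ (i : ℕ), ∀ y ∈ C, (h ^ i)⁻¹ y ∉ halfTree T v w := by
    intro i y hy hB
    rcases hpos i y hy with h1 | h1 | h1
    · exact hdisj a hua hwa _ hB h1
    · exact hu (h1 ▸ hB)
    · exact hdisj b hub' hwb _ hB h1
  have hfib : ∀ (i : ℕ), ∀ x ∈ halfTree T v w, (h ^ i) x ∈ fibre T C ((h ^ i) u) := by
    intro i x hx y hy
    rw [dist_map_iso, ← dist_map_iso (h ^ i)⁻¹ _ y, RelIso.inv_apply_self]
    rcases hpos i y hy with h1 | h1 | h1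
    · rw [T.dist_comm (v := (h ^ i)⁻¹ y),
        dist_eq_of_mem_halfTree hT hua h1 (hdisj a hua hwa x hx), T.dist_comm (u := u)]
      omega
    · rw [h1]
    · rw [T.dist_comm (v := (h ^ i)⁻¹ y),
        dist_eq_of_mem_halfTree hT hub' h1 (hdisj b hub' hwb x hx), T.dist_comm (u := u)]
      omega
  have hconj : ∀ i : ℕ, h ^ i * g * (h ^ i)⁻¹ ∈ fixator G (nbhd T C (k - 1)) := by
    intro i
    have hhG := G.pow_mem (hHG hh) i
    refine ⟨G.mul_mem (G.mul_mem hhG hg.1) (G.inv_mem hhG), ?_⟩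
    rintro z ⟨c, hc, hzc⟩
    have hgz : g ((h ^ i)⁻¹ z) = (h ^ i)⁻¹ z := by
      by_cases hz : (h ^ i)⁻¹ z ∈ halfTree T v w
      · refine hg.2 _ ⟨v, Or.inl rfl, ?_⟩
        have h1 := dist_eq_of_mem_halfTree hT hvw hz (hCB i c hc)
        rw [dist_map_iso] at h1
        omega
      · exact hfix _ hz
    rw [RelIso.mul_apply, RelIso.mul_apply, hgz, RelIso.apply_inv_self]
  have hinj : ∀ i j : ℕ, (h ^ i) u = (h ^ j) u → i = j := by
    intro i j hij
    have h1 := hdist i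
    rw [hij, hdist j] at h1
    exact (Nat.eq_of_mul_eq_mul_right hl h1).symm
  classical
  -- `f` acts as `h ^ i * g * (h ^ i)⁻¹` on the fibre over `(h ^ i) u` and trivially on the other
  -- fibres; `hinj` makes `i` unambiguous.
  obtain ⟨f, hf, hfγ⟩ := hP.exists_glue (C := C) (Or.inr (Or.inl ⟨r, hr, rfl⟩)) fun x =>
    if hx : ∃ i : ℕ, (h ^ i) u = x then ⟨_, hconj hx.choose⟩ else 1
  have hf1 : ∀ (i : ℕ), ∀ x ∈ halfTree T v w, f ((h ^ i) x) = (h ^ i) (g x) := by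
    intro i x hx
    have hex : ∃ j : ℕ, (h ^ j) u = (h ^ i) u := ⟨i, rfl⟩
    have := hfγ ⟨_, hrs i⟩ _ (hfib i x hx)
    rw [dif_pos hex] at this
    rw [this, hinj _ _ hex.choose_spec, RelIso.mul_apply, RelIso.mul_apply, RelIso.inv_apply_self]
  have hf2 : ∀ z, (∀ (i : ℕ), ∀ x ∈ halfTree T v w, z ≠ (h ^ i) x) → f z = z := by
    intro z hz
    obtain ⟨x, hx, hzx⟩ := exists_mem_fibre (T := T) (C := C) ⟨_, Set.mem_range_self 0⟩ z
    rw [hfγ ⟨x, hx⟩ z hzx]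
    split_ifs with hex
    · change (h ^ hex.choose * g * (h ^ hex.choose)⁻¹) z = z
      rw [RelIso.mul_apply, RelIso.mul_apply, hfix, RelIso.apply_inv_self]
      exact fun h' => hz _ _ h' (RelIso.apply_inv_self _ _).symm
    · rfl
  -- `h * f * h⁻¹` acts as `f` does on the translates with `i ≥ 1` and trivially on the half-tree
  -- itself, where `f` acts as `g`.
  have hcomm : f * h = g * (h * f) := by
    refine RelIso.ext fun z => ?_
    rw [RelIso.mul_apply, RelIso.mul_apply, RelIso.mul_apply]
    by_cases hz : ∃ i : ℕ, ∃ x ∈ halfTree T v w, z = (h ^ i) x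
    · obtain ⟨i, x, hx, rfl⟩ := hz
      have hgx : g x ∈ halfTree T v w := by
        by_contra h'
        have := g.injective (hfix _ h')
        rw [this] at h'
        exact h' hx
      have hsucc : ∀ y, h ((h ^ i) y) = (h ^ (i + 1)) y := fun y => by
        rw [pow_succ', RelIso.mul_apply]
      rw [hf1 i x hx, hsucc, hsucc, hf1 _ x hx, hfix ((h ^ (i + 1)) (g x))]
      exact fun h' => hdisj a hua hwa _ h' (hpow i _ (hBE _ hgx))
    · push Not at hz
      rw [hf2 z hz]
      by_cases hB : h z ∈ halfTree T v w
      · exact hf1 0 _ hB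
      · rw [hfix _ hB]
        refine hf2 _ fun i x hx h' => ?_
        rcases i with _ | i
        · exact hB (h' ▸ hx)
        · rw [pow_succ', RelIso.mul_apply] at h'
          exact hz i x hx (h.injective h')
  have hfplus : f ∈ plus k G :=
    mem_plus_of_mem_fixator_nbhd hT hf (Set.mem_range_self 0) (Set.mem_range_self 1) (hr 0).1
  have hg' : g = f * h * f⁻¹ * h⁻¹ := by
    rw [hcomm]
    group
  rw [hg']
  exact H.mul_mem (hH f hfplus h hh) (H.inv_mem hh)

theorem isPathSet_edge {v w : V} (hvw : T.Adj v w) : IsPathSet T {v, w} := by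
  refine Or.inl ⟨v, w, SimpleGraph.Walk.cons hvw SimpleGraph.Walk.nil, ?_, ?_⟩
  · simp [hvw.ne]
  · ext x
    simp

theorem mem_fibre_edge {v w x : V} (hx : x ∈ halfTree T v w) : x ∈ fibre T {v, w} w := by
  rintro y (rfl | rfl)
  · exact le_of_lt hx
  · exact le_rfl

theorem mem_of_mem_fixator (hT : T.IsTree) {k : ℕ} (hk : 1 ≤ k) {G H : Subgroup (T ≃g T)}
    (hP : PropertyP k G) (hHG : H ≤ G) (hflip : Flips H)
    (hH : ∀ g ∈ plus k G, ∀ h ∈ H, g * h * g⁻¹ ∈ H) {u₀ : V} (hu₀ : IsBranch T u₀)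
    {g : T ≃g T} {v w : V} (hvw : T.Adj v w) (hg : g ∈ fixator G (ball T v k ∩ ball T w k)) :
    g ∈ H := by
  classical
  have hg' : g ∈ fixator G (nbhd T {v, w} (k - 1)) := by
    refine ⟨hg.1, fun z hz => hg.2 z ?_⟩
    have h1 := hT.dist_eq_dist_add_one_of_adj z hvw
    obtain ⟨x, rfl | rfl, hx⟩ := hz
    · constructor
      · change T.dist x z ≤ k
        rw [T.dist_comm]
        omega
      · change T.dist w z ≤ k
        rw [T.dist_comm]
        omega
    · constructor
      · change T.dist v z ≤ k
        rw [T.dist_comm]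
        omega
      · change T.dist x z ≤ k
        rw [T.dist_comm]
        omega
  -- `f` agrees with `g` on the side of `w` and is trivial on the side of `v`, so `g * f⁻¹` is
  -- supported on the side of `v`.
  obtain ⟨f, hf, hfγ⟩ := hP.exists_glue (isPathSet_edge hvw)
    fun x => if x.1 = w then ⟨g, hg'⟩ else 1
  have hfw : ∀ z ∈ halfTree T v w, f z = g z := fun z hz => by
    rw [hfγ ⟨w, Or.inr rfl⟩ z (mem_fibre_edge hz), if_pos rfl]
  have hfv : ∀ z, z ∉ halfTree T v w → f z = z := fun z hz => by
    have h1 := mem_fibre_edge ((notMem_halfTree hT hvw).1 hz)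
    rw [Set.pair_comm] at h1
    rw [hfγ ⟨v, Or.inl rfl⟩ z h1, if_neg hvw.ne]
    rfl
  have h1 : f ∈ H := mem_of_fixes_halfTree hT hP hHG hflip hH hu₀ hvw hf hfv
  have h2 : g * f⁻¹ ∈ H := by
    refine mem_of_fixes_halfTree hT hP hHG hflip hH hu₀ hvw.symm (v := w) (w := v)
      (Set.pair_comm v w ▸ (fixator G _).mul_mem hg' ((fixator G _).inv_mem hf)) fun z hz => ?_
    replace hz := (notMem_halfTree hT hvw.symm).1 hz
    rw [RelIso.mul_apply]
    have h3 : f⁻¹ z ∈ halfTree T v w := by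
      by_contra h'
      have := hfv _ h'
      rw [RelIso.apply_inv_self] at this
      exact h' (this ▸ hz)
    rw [← hfw _ h3, RelIso.apply_inv_self]
  simpa using H.mul_mem h2 h1

/-! ### Normality of `plus k G` and conclusion -/

theorem plus_le (k : ℕ) (G : Subgroup (T ≃g T)) : plus k G ≤ G := by
  refine (Subgroup.closure_le G).2 ?_
  rintro g ⟨v, w, -, hg⟩
  exact hg.1

theorem conj_mem_plus {k : ℕ} {G : Subgroup (T ≃g T)} {g p : T ≃g T} (hg : g ∈ G)
    (hp : p ∈ plus k G) : g * p * g⁻¹ ∈ plus k G := by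
  induction hp using Subgroup.closure_induction with
  | mem x hx =>
    obtain ⟨v, w, hvw, hx⟩ := hx
    refine Subgroup.subset_closure ⟨g v, g w, adj_apply g hvw,
      G.mul_mem (G.mul_mem hg hx.1) (G.inv_mem hg), ?_⟩
    rintro z ⟨hz1, hz2⟩
    have hfix : x (g⁻¹ z) = g⁻¹ z := by
      refine hx.2 _ ⟨?_, ?_⟩
      · change T.dist v (g⁻¹ z) ≤ k
        rw [← dist_map_iso g, RelIso.apply_inv_self]
        exact hz1
      · change T.dist w (g⁻¹ z) ≤ k
        rw [← dist_map_iso g, RelIso.apply_inv_self]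
        exact hz2
    rw [RelIso.mul_apply, RelIso.mul_apply, hfix, RelIso.apply_inv_self]
  | one => simp
  | mul x y _ _ hx hy => simpa [mul_assoc] using (plus k G).mul_mem hx hy
  | inv x _ hx => simpa [mul_assoc] using (plus k G).inv_mem hx

theorem plus_le_of_normalised (hT : T.IsTree) {k : ℕ} (hk : 1 ≤ k) {G : Subgroup (T ≃g T)}
    (hsub : ¬ StabilisesAProperSubtree G) (hend : ¬ StabilisesAnEnd G) (hP : PropertyP k G)
    {H : Subgroup (T ≃g T)} (hHG : H ≤ G) (hne : H ≠ ⊥)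
    (hH : ∀ g ∈ plus k G, ∀ h ∈ H, g * h * g⁻¹ ∈ H) : plus k G ≤ H := by
  refine (Subgroup.closure_le H).2 ?_
  rintro g ⟨v, w, hvw, hg⟩
  by_cases hg1 : g = 1
  · exact hg1 ▸ H.one_mem
  have hdist := SimpleGraph.dist_eq_one_iff_adj.2 hvw
  -- `k ≥ 1` places both ends of the edge in `B(v,k) ∩ B(w,k)`.
  have hv : g v = v := hg.2 v ⟨by simp [ball], by
    change T.dist w v ≤ k
    rw [T.dist_comm]
    omega⟩
  have hw : g w = w := hg.2 w ⟨by
    change T.dist v w ≤ k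
    omega, by simp [ball]⟩
  obtain ⟨u, y, hu, huy, hgy⟩ := exists_isBranch_of_fixes_edge hT hg1 hvw hv hw
  have hplus : Flips (plus k G) := (flips_of_minimal hT hsub hend).of_normalised hT
    (fun f hf p hp => conj_mem_plus hf hp) (Subgroup.subset_closure ⟨v, w, hvw, hg⟩) huy hgy
  exact mem_of_mem_fixator hT hk hP hHG (hplus.of_ne_bot hT hu hH hne) hH hu hvw hg

end TreeAut

theorem mainTheorem1 {V : Type*} (T : SimpleGraph V) (hT : T.IsTree) (k : ℕ) (hk : 1 ≤ k)
    (G : Subgroup (T ≃g T))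
    (hsub : ¬ TreeAut.StabilisesAProperSubtree G)
    (hend : ¬ TreeAut.StabilisesAnEnd G)
    (hP : TreeAut.PropertyP k G) :
    (∀ H : Subgroup (T ≃g T), H ≤ G → H ≠ ⊥ →
      (∀ g ∈ TreeAut.plus k G, ∀ h ∈ H, g * h * g⁻¹ ∈ H) → TreeAut.plus k G ≤ H) ∧
    (IsSimpleGroup (TreeAut.plus k G) ∨ TreeAut.plus k G = ⊥) := by
  have main : ∀ H : Subgroup (T ≃g T), H ≤ G → H ≠ ⊥ →
      (∀ g ∈ TreeAut.plus k G, ∀ h ∈ H, g * h * g⁻¹ ∈ H) → TreeAut.plus k G ≤ H :=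
    fun H hHG hne hH => TreeAut.plus_le_of_normalised hT hk hsub hend hP hHG hne hH
  refine ⟨main, or_iff_not_imp_right.2 fun hbot => ?_⟩
  have : Nontrivial (TreeAut.plus k G) := (Subgroup.nontrivial_iff_ne_bot _).2 hbot
  refine ⟨fun N hN => or_iff_not_imp_left.2 fun hNbot => ?_⟩
  have hle : TreeAut.plus k G ≤ N.map (TreeAut.plus k G).subtype := by
    refine main _ ((Subgroup.map_subtype_le N).trans (TreeAut.plus_le k G)) ?_ ?_
    · rwa [Ne, Subgroup.map_eq_bot_iff_of_injective _ (Subgroup.subtype_injective _)]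
    · rintro g hg _ ⟨n, hn, rfl⟩
      exact ⟨⟨g, hg⟩ * n * ⟨g, hg⟩⁻¹, hN.conj_mem n hn ⟨g, hg⟩, rfl⟩
  refine eq_top_iff.2 fun x _ => ?_
  obtain ⟨n, hn, hnx⟩ := hle x.2
  rwa [← Subtype.ext hnx]
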